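/- **Language.** Let $\mathcal N$ be a countable set of variable names. A *state* is a finite partial function $\sigma$ from $\mathcal N$ to $\mathbb R$; the set $\Omega$ of states carries the Borel $\sigma$-algebra of the extended metric that equals $\sum_{x\in\mathrm{dom}\,\sigma}|\sigma(x)-\tau(x)|$ if $\mathrm{dom}\,\sigma=\mathrm{dom}\,\tau$ and $\infty$ otherwise. Put $\hat\Omega=\Omega\uplus\{\lightning,\uparrow\}$ (failure, divergence), each of the two new points being at distance $\infty$ from every other point, again with the Borel $\sigma$-algebra. Expressions $E$ and predicates $\phi$ have total measurable evaluation functions $\sigma\mapsto\sigma(E)\in\mathbb R$ and $\sigma\mapsto\sigma(\phi)\in\{\mathtt{true},\mathtt{false}\}$. Programs are $$C::=\mathtt{skip}\mid\mathtt{diverge}\mid x:=E\mid x:\approx U\mid\mathtt{observe}(\phi)\mid\mathtt{score}(E)\mid C;C\mid\mathtt{if}(\phi)\{C\}\mid\mathtt{while}(\phi)\{C\}.$$ **Weakest liberal preexpectation.** For measurable $f\colon\Omega\to[0,1]$, with Iverson brackets $[\cdot]$, define $\mathtt{wlp}[\![C]\!](f)\colon\Omega\to[0,1]$ by recursion on $C$: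 - $\mathtt{wlp}[\![\mathtt{skip}]\!](f)=f$ and $\mathtt{wlp}[\![\mathtt{diverge}]\!](f)=1$; - $\mathtt{wlp}[\![x:=E]\!](f)(\sigma)=f(\sigma[x\mapsto\sigma(E)])$; - $\mathtt{wlp}[\![x:\approx U]\!](f)(\sigma)=\int_{[0,1]}f(\sigma[x\mapsto v])\,dv$; - $\mathtt{wlp}[\![\mathtt{observe}(\phi)]\!](f)(\sigma)=[\sigma(\phi)]\,f(\sigma)$; - $\mathtt{wlp}[\![\mathtt{score}(E)]\!](f)(\sigma)=[\sigma(E)\in(0,1]]\,\sigma(E)\,f(\sigma)$; - $\mathtt{wlp}[\![C_1;C_2]\!](f)=\mathtt{wlp}[\![C_1]\!](\mathtt{wlp}[\![C_2]\!](f))$; - $\mathtt{wlp}[\![\mathtt{if}(\phi)\{C\}]\!](f)=[\phi]\,\mathtt{wlp}[\![C]\!](f)+[\neg\phi]\,f$; - $\mathtt{wlp}[\![\mathtt{while}(\phi)\{C\}]\!](f)$ is the greatest fixpoint of $X\mapsto[\neg\phi]f+[\phi]\,\mathtt{wlp}[\![C]\!](X)$ among the measurable functions $\Omega\to[0,1]$,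 ordered pointwise. **Entropy space.** Let $(\mathbb S,\mathcal S)$ be a measurable space with a probability measure $\mu$ and measurable maps $\pi_U\colon\mathbb S\to[0,1]$, $\pi_L,\pi_R\colon\mathbb S\to\mathbb S$ and a surjective $(::)\colon\mathbb S\times\mathbb S\to\mathbb S$ such that $\pi_L(\theta_L::\theta_R)=\theta_L$, $\pi_R(\theta_L::\theta_R)=\theta_R$, $\int f(\pi_U(\theta))\,\mu(d\theta)=\int_{[0,1]}f(x)\,dx$ and $\int g(\pi_L(\theta),\pi_R(\theta))\,\mu(d\theta)=\iint g(\theta_L,\theta_R)\,\mu(d\theta_L)\,\mu(d\theta_R)$ for all measurable $f\colon[0,1]\to[0,\infty]$ and $g\colon\mathbb S\times\mathbb S\to[0,\infty]$. **Operational semantics.** A configuration $\langle\theta,C,K,\sigma,\theta_K,n,w\rangle$ consists of an entropy, a current statement, a list of programs (the continuation), a state (or $\lightning$), an entropy for the continuation, a step count and a weight. The statement $\mathtt{skip}$ also serves as the symbol $\downarrow$ of a completed statement. For $\sigma\in\Omega$ the one-step reduction $\vdash$, which always increases $n$ by $1$ and leaves the components that are not mentioned unchanged, is given by: - $\mathtt{diverge}$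 stays $\mathtt{diverge}$; - $x:=E$ becomes $\downarrow$, with state $\sigma[x\mapsto\sigma(E)]$; - $x:\approx U$ becomes $\downarrow$, with state $\sigma[x\mapsto\pi_U(\pi_L(\theta))]$ and entropy $\pi_R(\theta)$; - $\mathtt{observe}(\phi)$ becomes $\downarrow$ if $\sigma(\phi)$ is true; otherwise it becomes $\downarrow$ with empty continuation and state $\lightning$; - $\mathtt{score}(E)$, if $\sigma(E)\in(0,1]$, becomes $\downarrow$ with weight $w\cdot\sigma(E)$; - a sequence, written by associativity of $;$ as $C_1;C_2$ with $C_1$ not a sequence, becomes $C_1$ with entropy $\pi_L(\theta)$, continuation $C_2::K$ and continuation entropy $\pi_R(\theta)::\theta_K$; - $\downarrow$ with continuation $C::K$ becomes $C$ with continuation $K$, entropy $\pi_L(\theta_K)$ and continuation entropy $\pi_R(\theta_K)$; - $\mathtt{if}(\phi)\{C\}$ becomes $C$ if $\sigma(\phi)$ is true and $\downarrow$ otherwise; - $\mathtt{while}(\phi)\{C\}$ becomes $C;\mathtt{while}(\phi)\{C\}$ if $\sigma(\phi)$ is true and $\downarrow$ otherwise; - $\downarrow$ with empty continuation stays the same.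 No other reduction is possible. Fix an arbitrary $\theta_K\in\mathbb S$ and let $\kappa_0=\langle\theta,C,[\,],\sigma,\theta_K,0,1\rangle$ with $\sigma\in\Omega$. Then $\mathbf O_C^\sigma(\theta)$ is $\tau\in\Omega$ if $\kappa_0\vdash^*\langle\theta',\downarrow,[\,],\tau,\theta_K,n,w\rangle$ for some $\theta',n,w$; it is $\lightning$ if $\kappa_0\vdash^*\kappa$ for an irreducible $\kappa$; and it is $\uparrow$ otherwise. Further, $\mathbf{SC}_C^\sigma(\theta,n)=w$ if $\kappa_0$ reduces to a configuration with step count $n$, weight $w$ and state other than $\lightning$, and $\mathbf{SC}_C^\sigma(\theta,n)=0$ if there is none; and $\mathbf{SC}_C^\sigma(\theta)=\lim_n\mathbf{SC}_C^\sigma(\theta,n)=\inf_n\mathbf{SC}_C^\sigma(\theta,n)$. Let $[\![C]\!]_\sigma$ be the push-forward under $\mathbf O_C^\sigma$ of the measure $B\mapsto\int_B\mathbf{SC}_C^\sigma\,d\mu$ on $\mathbb S$, and let $[\![C]\!]_\sigma|_\Omega$ be its restriction to $\Omega$. **Theorem.** For every measurable $f\colon\Omega\to[0,\infty]$ with $f\le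 1$, every program $C$ and every initial state $\sigma\in\Omega$, $$\mathtt{wlp}[\![C]\!](f)(\sigma)=\int_\Omega f(\tau)\;[\![C]\!]_\sigma|_{\Omega}(d\tau)+\int_{\mathbb S}[\mathbf O_C^\sigma(\theta)=\uparrow]\cdot\mathbf{SC}_C^\sigma(\theta)\,\mu(d\theta).$$ -/

import Mathlib

open scoped ENNReal NNReal

noncomputable section

namespace PL

/-! ### Program states -/

/-- A program state: a finite set `dom` of variable names together with a real value for each of
them. The function `val` is set to `0` off `dom`, so that a state is determined by its domain and
its values there. -/
@[ext]
structure State (N : Type*) where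
  dom : Finset N
  val : N → ℝ
  val_eq_zero : ∀ x, x ∉ dom → val x = 0

/-- `σ[x ↦ v]`. -/
def State.update {N : Type*} [DecidableEq N] (σ : State N) (x : N) (v : ℝ) : State N where
  dom := insert x σ.dom
  val := Function.update σ.val x v
  val_eq_zero := by
    intro y hy
    rw [Finset.mem_insert, not_or] at hy
    rw [Function.update_of_ne hy.1]
    exact σ.val_eq_zero y hy.2

open Classical in
/-- The distance of two states: the Manhattan distance of the values if the domains agree, and
`∞` otherwise. -/
def State.dist {N : Type*} (σ τ : State N) : ℝ≥0∞ :=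
  if σ.dom = τ.dom then ∑ x ∈ σ.dom, ENNReal.ofReal |σ.val x - τ.val x| else ⊤

theorem State.dist_eq {N : Type*} {σ τ : State N} (h : σ.dom = τ.dom) :
    State.dist σ τ = ∑ x ∈ σ.dom, edist (σ.val x) (τ.val x) := by
  simp only [State.dist, if_pos h, edist_dist, Real.dist_eq]

instance {N : Type*} : EMetricSpace (State N) where
  edist := State.dist
  edist_self σ := by rw [State.dist_eq rfl]; simp
  edist_comm σ τ := by
    by_cases h : σ.dom = τ.dom
    · rw [State.dist_eq h, State.dist_eq h.symm, h]
      exact Finset.sum_congr rfl fun x _ => edist_comm _ _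
    · simp only [State.dist, if_neg h, if_neg (Ne.symm h)]
  edist_triangle ρ σ τ := by
    by_cases h : ρ.dom = σ.dom
    · by_cases h' : σ.dom = τ.dom
      · rw [State.dist_eq h, State.dist_eq h', State.dist_eq (h.trans h'), ← h,
          ← Finset.sum_add_distrib]
        exact Finset.sum_le_sum fun x _ => edist_triangle _ _ _
      · simp only [State.dist, if_neg h', add_top, le_top]
    · simp only [State.dist, if_neg h, top_add, le_top]
  eq_of_edist_eq_zero := by
    intro σ τ h0
    change State.dist σ τ = 0 at h0
    by_cases h : σ.dom = τ.dom
    · rw [State.dist_eq h, Finset.sum_eq_zero_iff] at h0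
      refine State.ext h (funext fun x => ?_)
      by_cases hx : x ∈ σ.dom
      · exact edist_eq_zero.1 (h0 x hx)
      · rw [σ.val_eq_zero x hx, τ.val_eq_zero x (h ▸ hx)]
    · simp [State.dist, if_neg h] at h0

/-- The Borel σ-algebra of the metric on states. -/
instance {N : Type*} : MeasurableSpace (State N) := borel (State N)

instance {N : Type*} : BorelSpace (State N) := ⟨rfl⟩

/-- States extended by `fail` (a failed observation or an evaluation error) and `div`
(divergence). -/
inductive ExtState (N : Type*) where
  | proper (σ : State N)
  | fail
  | div

/-- The metric on states, extended so that `fail` and `div` are at distance `∞` from everything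
else. -/
def ExtState.dist {N : Type*} : ExtState N → ExtState N → ℝ≥0∞
  | .proper σ, .proper τ => edist σ τ
  | .fail, .fail => 0
  | .div, .div => 0
  | _, _ => ⊤

instance {N : Type*} : EMetricSpace (ExtState N) where
  edist := ExtState.dist
  edist_self σ := by cases σ <;> simp [ExtState.dist]
  edist_comm σ τ := by cases σ <;> cases τ <;> simp [ExtState.dist, edist_comm]
  edist_triangle ρ σ τ := by
    cases ρ <;> cases σ <;> cases τ <;> simp [ExtState.dist, edist_triangle]
  eq_of_edist_eq_zero := by
    intro σ τ h
    change ExtState.dist σ τ = 0 at h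
    cases σ <;> cases τ <;> simp_all [ExtState.dist]

/-- The Borel σ-algebra of the metric on extended states. -/
instance {N : Type*} : MeasurableSpace (ExtState N) := borel (ExtState N)

instance {N : Type*} : BorelSpace (ExtState N) := ⟨rfl⟩

/-! ### Syntax -/

/-- An arithmetic expression, given by its total and measurable evaluation function. -/
structure Expr (N : Type*) where
  eval : State N → ℝ
  measurable_eval : Measurable eval

/-- A predicate, given by its total and measurable evaluation function. -/
structure Pred (N : Type*) where
  eval : State N → Bool
  measurable_eval : Measurable eval

inductive Prog (N : Type*) where
  | skip
  | diverge
  | assign (x : N) (E : Expr N)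
  | draw (x : N)
  | observe (φ : Pred N)
  | score (E : Expr N)
  | seq (C₁ C₂ : Prog N)
  | ifThen (φ : Pred N) (C : Prog N)
  | while (φ : Pred N) (C : Prog N)

/-- The splitting of the sequence `C₁; C₂` into its first statement, which is not a sequence, and
the sequence of the remaining statements; sequences are read up to associativity of `;`, so that
`(A; B); C` is split as `A; (B; C)`. If `C₁` is not a sequence, the result is `(C₁, C₂)`. -/
def Prog.split {N : Type*} : Prog N → Prog N → Prog N × Prog N
  | .seq A B, C => Prog.split A (.seq B C)
  | A, C => (A, C)

/-! ### Weakest liberal preexpectations -/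

open Classical in
/-- Iverson bracket. -/
def iverson (p : Prop) : ℝ≥0∞ := if p then 1 else 0

open Classical in
/-- The greatest fixpoint of `Φ` in the set of measurable functions from states to `[0,1]`,
ordered pointwise (with the value `0` if there is none). -/
def gfp {N : Type*} (Φ : (State N → ℝ≥0∞) → State N → ℝ≥0∞) : State N → ℝ≥0∞ :=
  if h : ∃ X, IsGreatest {X : State N → ℝ≥0∞ | Measurable X ∧ (∀ σ, X σ ≤ 1) ∧ Φ X = X} X
  then h.choose else 0

/-- The weakest liberal preexpectation transformer, meant for measurable `f` with `f ≤ 1`. -/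
def wlp {N : Type*} [DecidableEq N] : Prog N → (State N → ℝ≥0∞) → State N → ℝ≥0∞
  | .skip, f => f
  | .diverge, _ => fun _ => 1
  | .assign x E, f => fun σ => f (σ.update x (E.eval σ))
  | .draw x, f => fun σ => ∫⁻ v : unitInterval, f (σ.update x v)
  | .observe φ, f => fun σ => iverson (φ.eval σ = true) * f σ
  | .score E, f => fun σ =>
      iverson (E.eval σ ∈ Set.Ioc (0 : ℝ) 1) * ENNReal.ofReal (E.eval σ) * f σ
  | .seq C₁ C₂, f => wlp C₁ (wlp C₂ f)
  | .ifThen φ C, f => fun σ =>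
      iverson (φ.eval σ = true) * wlp C f σ + iverson (φ.eval σ = false) * f σ
  | .while φ C, f => gfp fun X σ =>
      iverson (φ.eval σ = false) * f σ + iverson (φ.eval σ = true) * wlp C X σ

/-! ### Entropy spaces -/

open MeasureTheory in
/-- An entropy space structure on the measurable space `S`. -/
structure EntropySpace (S : Type*) [MeasurableSpace S] where
  μ : Measure S
  measure_univ : μ Set.univ = 1
  πU : S → unitInterval
  πL : S → S
  πR : S → S
  pair : S → S → S
  measurable_πU : Measurable πU
  measurable_πL : Measurable πL
  measurable_πR : Measurable πR
  measurable_pair : Measurable fun p : S × S => pair p.1 p.2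
  lintegral_πU : ∀ f : unitInterval → ℝ≥0∞, Measurable f →
    ∫⁻ θ, f (πU θ) ∂μ = ∫⁻ x, f x
  pair_surjective : ∀ θ, ∃ θL θR, pair θL θR = θ
  πL_pair : ∀ θL θR, πL (pair θL θR) = θL
  πR_pair : ∀ θL θR, πR (pair θL θR) = θR
  lintegral_πL_πR : ∀ g : S × S → ℝ≥0∞, Measurable g →
    ∫⁻ θ, g (πL θ, πR θ) ∂μ = ∫⁻ θR, ∫⁻ θL, g (θL, θR) ∂μ ∂μ

/-! ### Operational semantics -/

/-- A configuration `⟨θ, C, K, σ, θ_K, n, w⟩`. The symbol `↓` of successful termination of the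
current statement is the statement `skip`, for which there is nothing left to do. -/
structure Config (N S : Type*) where
  entropy : S
  stmt : Prog N
  cont : List (Prog N)
  state : ExtState N
  contEntropy : S
  steps : ℕ
  weight : ℝ≥0

/-- The one-step reduction relation on configurations. -/
inductive Step {N S : Type*} [DecidableEq N] [MeasurableSpace S] (Θ : EntropySpace S) :
    Config N S → Config N S → Prop
  | diverge (θ : S) (K : List (Prog N)) (σ : State N) (θK : S) (n : ℕ) (w : ℝ≥0) :
      Step Θ ⟨θ, .diverge, K, .proper σ, θK, n, w⟩ ⟨θ, .diverge, K, .proper σ, θK, n + 1, w⟩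
  | assign (θ : S) (x : N) (E : Expr N) (K : List (Prog N)) (σ : State N) (θK : S) (n : ℕ)
      (w : ℝ≥0) :
      Step Θ ⟨θ, .assign x E, K, .proper σ, θK, n, w⟩
        ⟨θ, .skip, K, .proper (σ.update x (E.eval σ)), θK, n + 1, w⟩
  | draw (θ : S) (x : N) (K : List (Prog N)) (σ : State N) (θK : S) (n : ℕ) (w : ℝ≥0) :
      Step Θ ⟨θ, .draw x, K, .proper σ, θK, n, w⟩
        ⟨Θ.πR θ, .skip, K, .proper (σ.update x (Θ.πU (Θ.πL θ))), θK, n + 1, w⟩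
  | observe_true (θ : S) (φ : Pred N) (K : List (Prog N)) (σ : State N) (θK : S) (n : ℕ)
      (w : ℝ≥0) (h : φ.eval σ = true) :
      Step Θ ⟨θ, .observe φ, K, .proper σ, θK, n, w⟩ ⟨θ, .skip, K, .proper σ, θK, n + 1, w⟩
  | observe_false (θ : S) (φ : Pred N) (K : List (Prog N)) (σ : State N) (θK : S) (n : ℕ)
      (w : ℝ≥0) (h : φ.eval σ = false) :
      Step Θ ⟨θ, .observe φ, K, .proper σ, θK, n, w⟩ ⟨θ, .skip, [], .fail, θK, n + 1, w⟩
  | score (θ : S) (E : Expr N) (K : List (Prog N)) (σ : State N) (θK : S) (n : ℕ) (w : ℝ≥0)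
      (h : E.eval σ ∈ Set.Ioc (0 : ℝ) 1) :
      Step Θ ⟨θ, .score E, K, .proper σ, θK, n, w⟩
        ⟨θ, .skip, K, .proper σ, θK, n + 1, w * (E.eval σ).toNNReal⟩
  | seq (θ : S) (C₁ C₂ : Prog N) (K : List (Prog N)) (σ : State N) (θK : S) (n : ℕ) (w : ℝ≥0) :
      Step Θ ⟨θ, .seq C₁ C₂, K, .proper σ, θK, n, w⟩
        ⟨Θ.πL θ, (C₁.split C₂).1, (C₁.split C₂).2 :: K, .proper σ, Θ.pair (Θ.πR θ) θK, n + 1, w⟩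
  | pop (θ : S) (C : Prog N) (K : List (Prog N)) (σ : State N) (θK : S) (n : ℕ) (w : ℝ≥0) :
      Step Θ ⟨θ, .skip, C :: K, .proper σ, θK, n, w⟩
        ⟨Θ.πL θK, C, K, .proper σ, Θ.πR θK, n + 1, w⟩
  | if_true (θ : S) (φ : Pred N) (C : Prog N) (K : List (Prog N)) (σ : State N) (θK : S) (n : ℕ)
      (w : ℝ≥0) (h : φ.eval σ = true) :
      Step Θ ⟨θ, .ifThen φ C, K, .proper σ, θK, n, w⟩ ⟨θ, C, K, .proper σ, θK, n + 1, w⟩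
  | if_false (θ : S) (φ : Pred N) (C : Prog N) (K : List (Prog N)) (σ : State N) (θK : S) (n : ℕ)
      (w : ℝ≥0) (h : φ.eval σ = false) :
      Step Θ ⟨θ, .ifThen φ C, K, .proper σ, θK, n, w⟩ ⟨θ, .skip, K, .proper σ, θK, n + 1, w⟩
  | while_true (θ : S) (φ : Pred N) (C : Prog N) (K : List (Prog N)) (σ : State N) (θK : S)
      (n : ℕ) (w : ℝ≥0) (h : φ.eval σ = true) :
      Step Θ ⟨θ, .while φ C, K, .proper σ, θK, n, w⟩
        ⟨θ, .seq C (.while φ C), K, .proper σ, θK, n + 1, w⟩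
  | while_false (θ : S) (φ : Pred N) (C : Prog N) (K : List (Prog N)) (σ : State N) (θK : S)
      (n : ℕ) (w : ℝ≥0) (h : φ.eval σ = false) :
      Step Θ ⟨θ, .while φ C, K, .proper σ, θK, n, w⟩ ⟨θ, .skip, K, .proper σ, θK, n + 1, w⟩
  | final (θ : S) (σ : State N) (θK : S) (n : ℕ) (w : ℝ≥0) :
      Step Θ ⟨θ, .skip, [], .proper σ, θK, n, w⟩ ⟨θ, .skip, [], .proper σ, θK, n + 1, w⟩

/-- Reduction in zero or more steps. -/
def Steps {N S : Type*} [DecidableEq N] [MeasurableSpace S] (Θ : EntropySpace S) :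
    Config N S → Config N S → Prop :=
  Relation.ReflTransGen (Step Θ)

/-- The initial configuration. -/
def Config.init {N S : Type*} (θK : S) (C : Prog N) (σ : ExtState N) (θ : S) : Config N S :=
  ⟨θ, C, [], σ, θK, 0, 1⟩

open Classical in
/-- The final state `O_C^σ(θ)` of the run of `C` from `σ` with entropy `θ`, where `θK` is the
initial entropy of the (empty) continuation. -/
def finalState {N S : Type*} [DecidableEq N] [MeasurableSpace S] (Θ : EntropySpace S) (θK : S)
    (C : Prog N) : ExtState N → S → ExtState N
  | .div, _ => .div
  | σ, θ =>
    if h : ∃ τ : State N, ∃ (θ' : S) (n : ℕ) (w : ℝ≥0),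
        Steps Θ (Config.init θK C σ θ) ⟨θ', .skip, [], .proper τ, θK, n, w⟩ then
      .proper h.choose
    else if ∃ κ, Steps Θ (Config.init θK C σ θ) κ ∧ ∀ κ', ¬ Step Θ κ κ' then .fail
    else .div

open Classical in
/-- The score `SC_C^σ(θ, n)` after `n` steps. -/
def scoreAt {N S : Type*} [DecidableEq N] [MeasurableSpace S] (Θ : EntropySpace S) (θK : S)
    (C : Prog N) (σ : ExtState N) (θ : S) (n : ℕ) : ℝ≥0 :=
  if h : ∃ κ, Steps Θ (Config.init θK C σ θ) κ ∧ κ.steps = n ∧ κ.state ≠ .fail then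
    h.choose.weight
  else 0

/-- The score `SC_C^σ(θ)`. -/
def finalScore {N S : Type*} [DecidableEq N] [MeasurableSpace S] (Θ : EntropySpace S) (θK : S)
    (C : Prog N) : ExtState N → S → ℝ≥0
  | .div, _ => 1
  | .fail, _ => 0
  | .proper σ, θ => ⨅ n, scoreAt Θ θK C (.proper σ) θ n

open MeasureTheory in
/-- The measure `⟨C⟩_σ` on entropies. -/
def entropyMeasure {N S : Type*} [DecidableEq N] [MeasurableSpace S] (Θ : EntropySpace S) (θK : S)
    (C : Prog N) (σ : ExtState N) : Measure S :=
  Θ.μ.withDensity fun θ => (finalScore Θ θK C σ θ : ℝ≥0∞)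

open MeasureTheory in
/-- The measure `⟦C⟧_σ` on extended states. -/
def opMeasure {N S : Type*} [DecidableEq N] [MeasurableSpace S] (Θ : EntropySpace S) (θK : S)
    (C : Prog N) (σ : ExtState N) : Measure (ExtState N) :=
  (entropyMeasure Θ θK C σ).map (finalState Θ θK C σ)

open MeasureTheory in
/-- The restriction of `⟦C⟧_σ` to the proper states. -/
def opMeasureProper {N S : Type*} [DecidableEq N] [MeasurableSpace S] (Θ : EntropySpace S) (θK : S)
    (C : Prog N) (σ : ExtState N) : Measure (State N) :=
  (opMeasure Θ θK C σ).comap ExtState.proper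

end PL

end

noncomputable section

namespace PL

open MeasureTheory

variable {N : Type*}

/-! ### Measurability of states -/

theorem State.isOpen_dom_eq (D : Finset N) : IsOpen {σ : State N | σ.dom = D} := by
  rw [EMetric.isOpen_iff]
  intro σ hσ
  refine ⟨1, one_pos, fun τ hτ => ?_⟩
  by_contra hne
  have hd : τ.dom ≠ σ.dom := fun h => hne (h.trans hσ)
  have : edist τ σ = ⊤ := by
    change State.dist τ σ = ⊤
    simp only [State.dist, if_neg hd]
  rw [Metric.mem_eball, this] at hτ
  exact absurd hτ (by simp)

theorem State.edist_val_le (σ τ : State N) (y : N) : edist (σ.val y) (τ.val y) ≤ edist σ τ := by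
  change _ ≤ State.dist σ τ
  by_cases h : σ.dom = τ.dom
  · rw [State.dist_eq h]
    by_cases hy : y ∈ σ.dom
    · exact Finset.single_le_sum (f := fun x => edist (σ.val x) (τ.val x))
        (fun _ _ => zero_le) hy
    · rw [σ.val_eq_zero y hy, τ.val_eq_zero y (h ▸ hy)]
      simp
  · simp only [State.dist, if_neg h, le_top]

theorem State.measurable_val (y : N) : Measurable fun σ : State N => σ.val y := by
  have : LipschitzWith 1 fun σ : State N => σ.val y := fun σ τ => by
    simpa using State.edist_val_le σ τ y
  exact this.continuous.measurable

open Classical in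
/-- The state with domain `D` and prescribed values on `D`. -/
def State.ofFun (D : Finset N) (a : D → ℝ) : State N where
  dom := D
  val x := if h : x ∈ D then a ⟨x, h⟩ else 0
  val_eq_zero _ hx := dif_neg hx

theorem State.measurable_ofFun (D : Finset N) : Measurable (State.ofFun D) := by
  have : LipschitzWith (D.card : ℝ≥0) (State.ofFun D) := fun a b => by
    change State.dist _ _ ≤ _
    rw [State.dist_eq (σ := State.ofFun D a) (τ := State.ofFun D b) rfl]
    change ∑ x ∈ D, _ ≤ _
    calc ∑ x ∈ D, edist ((State.ofFun D a).val x) ((State.ofFun D b).val x)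
        ≤ ∑ _x ∈ D, edist a b := Finset.sum_le_sum fun x hx => by
          simpa [State.ofFun, hx] using edist_le_pi_edist a b ⟨x, hx⟩
      _ = _ := by simp
  exact this.continuous.measurable

theorem State.ofFun_dom_val (σ : State N) : State.ofFun σ.dom (fun x => σ.val x) = σ := by
  refine State.ext rfl (funext fun x => ?_)
  by_cases h : x ∈ σ.dom
  · simp [State.ofFun, h]
  · simp [State.ofFun, h, σ.val_eq_zero x h]

theorem State.measurable_of_dom_val [Countable N] {X : Type*} [MeasurableSpace X]
    {g : X → State N} (hd : ∀ D, MeasurableSet {a | (g a).dom = D})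
    (hv : ∀ y, Measurable fun a => (g a).val y) : Measurable g := by
  intro B hB
  have : g ⁻¹' B = ⋃ D : Finset N, {a | (g a).dom = D} ∩
      (fun a => State.ofFun D fun x => (g a).val x) ⁻¹' B := by
    ext a
    simp only [Set.mem_preimage, Set.mem_iUnion, Set.mem_inter_iff, Set.mem_ofPred_eq,
      exists_eq_left', State.ofFun_dom_val]
  rw [this]
  refine MeasurableSet.iUnion fun D => (hd D).inter ?_
  exact ((State.measurable_ofFun D).comp (measurable_pi_lambda _ fun x => hv x)) hB

theorem State.measurable_update [Countable N] [DecidableEq N] (x : N) :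
    Measurable fun p : State N × ℝ => p.1.update x p.2 := by
  refine State.measurable_of_dom_val (fun D => ?_) fun y => ?_
  · have : {p : State N × ℝ | (p.1.update x p.2).dom = D} =
        ⋃ D' : {D' : Finset N // insert x D' = D}, Prod.fst ⁻¹' {σ : State N | σ.dom = D'} := by
      ext p
      simp [State.update]
    rw [this]
    exact MeasurableSet.iUnion fun D' => measurable_fst (State.isOpen_dom_eq _).measurableSet
  · by_cases h : y = x
    · subst h
      simpa [State.update] using measurable_snd
    · have : Measurable ((fun σ : State N => σ.val y) ∘ (Prod.fst : State N × ℝ → State N)) :=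
        (State.measurable_val y).comp measurable_fst
      simpa [State.update, h, Function.comp_def] using this

theorem measurable_update_comp [Countable N] [DecidableEq N] {X : Type*} [MeasurableSpace X]
    (x : N) {g : X → State N} {v : X → ℝ} (hg : Measurable g) (hv : Measurable v) :
    Measurable fun a => (g a).update x (v a) :=
  (State.measurable_update x).comp (hg.prodMk hv)

theorem ExtState.measurableEmbedding_proper :
    MeasurableEmbedding (ExtState.proper : State N → ExtState N) := by
  have hi : Isometry (ExtState.proper : State N → ExtState N) := fun _ _ => rfl
  refine hi.isEmbedding.measurableEmbedding (IsOpen.measurableSet ?_)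
  rw [EMetric.isOpen_iff]
  rintro _ ⟨σ, rfl⟩
  refine ⟨1, one_pos, fun τ hτ => ?_⟩
  rw [Metric.mem_eball] at hτ
  change ExtState.dist _ _ < 1 at hτ
  cases τ with
  | proper τ => exact ⟨τ, rfl⟩
  | fail => simp [ExtState.dist] at hτ
  | div => simp [ExtState.dist] at hτ

/-! ### Iverson brackets -/

theorem iverson_mul (p : Prop) [Decidable p] (a : ℝ≥0∞) :
    iverson p * a = if p then a else 0 := by
  by_cases h : p <;> simp [iverson, h]

theorem iverson_add_iverson (b : Bool) (x y : ℝ≥0∞) :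
    iverson (b = true) * x + iverson (b = false) * y = if b = true then x else y := by
  cases b <;> simp [iverson]

theorem iverson_add_iverson' (b : Bool) (x y : ℝ≥0∞) :
    iverson (b = false) * y + iverson (b = true) * x = if b = true then x else y := by
  cases b <;> simp [iverson]

theorem ite_le_ite_of_le {p : Prop} [Decidable p] {a b c d : ℝ≥0∞} (h : a ≤ c) (h' : b ≤ d) :
    (if p then a else b) ≤ if p then c else d := by
  split_ifs; exacts [h, h']

theorem Pred.measurableSet (φ : Pred N) : MeasurableSet {σ | φ.eval σ = true} :=
  φ.measurable_eval (measurableSet_singleton true)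

/-- The factor by which `score(E)` multiplies the weight. -/
def Expr.factor (E : Expr N) (σ : State N) : ℝ≥0∞ :=
  iverson (E.eval σ ∈ Set.Ioc (0 : ℝ) 1) * ENNReal.ofReal (E.eval σ)

theorem Expr.factor_le_one (E : Expr N) (σ : State N) : E.factor σ ≤ 1 := by
  classical
  rw [Expr.factor, iverson_mul]
  split_ifs with h
  · exact ENNReal.ofReal_le_one.2 h.2
  · exact zero_le

theorem Expr.measurable_factor (E : Expr N) : Measurable E.factor := by
  classical
  unfold Expr.factor
  simp only [iverson_mul]
  exact Measurable.ite (E.measurable_eval measurableSet_Ioc)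
    (ENNReal.measurable_ofReal.comp E.measurable_eval) measurable_const

/-! ### Weakest liberal preexpectations are continuous from above -/

/-- Measurable functions from states to `[0,1]`. -/
def Preexp (f : State N → ℝ≥0∞) : Prop := Measurable f ∧ ∀ σ, f σ ≤ 1

theorem Preexp.iInf {f : ℕ → State N → ℝ≥0∞} (hf : ∀ n, Preexp (f n)) : Preexp (⨅ n, f n) :=
  ⟨by
    have : (⨅ n, f n) = fun σ => ⨅ n, f n σ := by funext σ; exact iInf_apply
    rw [this]
    exact Measurable.iInf fun n => (hf n).1, fun σ => by
    rw [iInf_apply]; exact (iInf_le _ 0).trans ((hf 0).2 σ)⟩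

theorem Preexp.one : Preexp (1 : State N → ℝ≥0∞) := ⟨measurable_one, fun _ => le_rfl⟩

/-- Monotone transformers of preexpectations that preserve infima of decreasing sequences. -/
structure IsCocontinuous (T : (State N → ℝ≥0∞) → State N → ℝ≥0∞) : Prop where
  preexp : ∀ {f}, Preexp f → Preexp (T f)
  mono : ∀ {f g}, Preexp f → Preexp g → f ≤ g → T f ≤ T g
  map_iInf : ∀ {f : ℕ → State N → ℝ≥0∞}, (∀ n, Preexp (f n)) → Antitone f →
    T (⨅ n, f n) = ⨅ n, T (f n)

namespace IsCocontinuous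

variable {T T' : (State N → ℝ≥0∞) → State N → ℝ≥0∞}

theorem id : IsCocontinuous (fun f : State N → ℝ≥0∞ => f) :=
  ⟨fun h => h, fun _ _ h => h, fun _ _ => rfl⟩

theorem const {g : State N → ℝ≥0∞} (hg : Preexp g) : IsCocontinuous (fun _ => g) :=
  ⟨fun _ => hg, fun _ _ _ => le_rfl, fun _ _ => (ciInf_const).symm⟩

theorem comp (h : IsCocontinuous T) (h' : IsCocontinuous T') :
    IsCocontinuous (fun f => T (T' f)) where
  preexp hf := h.preexp (h'.preexp hf)
  mono hf hg hfg := h.mono (h'.preexp hf) (h'.preexp hg) (h'.mono hf hg hfg)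
  map_iInf hf ha := by
    rw [h'.map_iInf hf ha]
    exact h.map_iInf (fun n => h'.preexp (hf n)) fun m n hmn => h'.mono (hf n) (hf m) (ha hmn)

theorem ite (φ : Pred N) (h : IsCocontinuous T) (h' : IsCocontinuous T') :
    IsCocontinuous (fun f σ => if φ.eval σ = true then T f σ else T' f σ) where
  preexp hf := ⟨Measurable.ite φ.measurableSet (h.preexp hf).1 (h'.preexp hf).1, fun σ => by
    dsimp only; split_ifs; exacts [(h.preexp hf).2 σ, (h'.preexp hf).2 σ]⟩
  mono hf hg hfg σ := by
    dsimp only; split_ifs; exacts [h.mono hf hg hfg σ, h'.mono hf hg hfg σ]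
  map_iInf hf ha := by
    funext σ
    simp only [iInf_apply, h.map_iInf hf ha, h'.map_iInf hf ha]
    split_ifs <;> rfl

theorem mul {a : State N → ℝ≥0∞} (ha : Preexp a) :
    IsCocontinuous (fun f σ => a σ * f σ) where
  preexp hf := ⟨ha.1.mul hf.1, fun σ => mul_le_one' (ha.2 σ) (hf.2 σ)⟩
  mono _ _ hfg σ := mul_le_mul_right (hfg σ) _
  map_iInf _ _ := by
    funext σ
    simp only [iInf_apply]
    exact ENNReal.mul_iInf fun h =>
      absurd h (ne_top_of_le_ne_top ENNReal.one_ne_top (ha.2 σ))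

theorem subst {u : State N → State N} (hu : Measurable u) :
    IsCocontinuous (fun f σ => f (u σ)) :=
  ⟨fun hf => ⟨hf.1.comp hu, fun _ => hf.2 _⟩, fun _ _ h _ => h _, fun _ _ => by
    funext σ; simp only [iInf_apply]⟩

theorem draw [Countable N] [DecidableEq N] (x : N) :
    IsCocontinuous (fun (f : State N → ℝ≥0∞) σ => ∫⁻ v : unitInterval, f (σ.update x v)) := by
  have hu : Measurable fun p : State N × unitInterval => p.1.update x p.2 :=
    measurable_update_comp x measurable_fst (measurable_subtype_coe.comp measurable_snd)
  have hle : ∀ f : State N → ℝ≥0∞, Preexp f → ∀ σ : State N,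
      ∫⁻ v : unitInterval, f (σ.update x v) ≤ 1 := fun f hf σ =>
    (lintegral_mono fun v => hf.2 _).trans (by simp)
  refine ⟨fun {f} hf => ⟨?_, hle f hf⟩, fun _ _ h σ => lintegral_mono fun v => h _, ?_⟩
  · exact (hf.1.comp hu).lintegral_prod_right'
  · intro f hf ha
    funext σ
    simp only [iInf_apply]
    exact lintegral_iInf (fun n => (hf n).1.comp (hu.comp measurable_prodMk_left))
      (fun m n hmn v => ha hmn _) (ne_top_of_le_ne_top ENNReal.one_ne_top (hle _ (hf 0) σ))

theorem iterate (h : IsCocontinuous T) (n : ℕ) : Preexp (T^[n] 1) := by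
  induction n with
  | zero => exact Preexp.one
  | succ n ih => rw [Function.iterate_succ_apply']; exact h.preexp ih

theorem antitone_iterate (h : IsCocontinuous T) : Antitone fun n => T^[n] 1 := by
  refine antitone_nat_of_succ_le fun n => ?_
  induction n with
  | zero => exact (h.preexp Preexp.one).2
  | succ n ih =>
    exact (Function.iterate_succ_apply' T (n + 1) 1).le.trans
      ((h.mono (h.iterate (n + 1)) (h.iterate n) ih).trans
        (Function.iterate_succ_apply' T n 1).ge)

theorem le_iInf_iterate (h : IsCocontinuous T) {X : State N → ℝ≥0∞} (hX : Preexp X)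
    (hle : X ≤ T X) : X ≤ ⨅ n, T^[n] 1 := by
  refine le_iInf fun n => ?_
  induction n with
  | zero => exact hX.2
  | succ n ih =>
    rw [Function.iterate_succ_apply']
    exact hle.trans (h.mono hX (h.iterate n) ih)

theorem map_iInf_iterate (h : IsCocontinuous T) : T (⨅ n, T^[n] 1) = ⨅ n, T^[n] 1 := by
  rw [h.map_iInf h.iterate h.antitone_iterate]
  refine le_antisymm (le_iInf fun n => ?_) (le_iInf fun n => ?_)
  · exact (iInf_le _ n).trans
      ((Function.iterate_succ_apply' T n 1).symm.le.trans (h.antitone_iterate n.le_succ))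
  · rw [← Function.iterate_succ_apply' T n 1]
    exact iInf_le (fun n => T^[n] 1) (n + 1)

theorem gfp_eq (h : IsCocontinuous T) : gfp T = ⨅ n, T^[n] 1 := by
  have hg : IsGreatest {X : State N → ℝ≥0∞ | Measurable X ∧ (∀ σ, X σ ≤ 1) ∧ T X = X}
      (⨅ n, T^[n] 1) := by
    have hp := Preexp.iInf h.iterate
    exact ⟨⟨hp.1, hp.2, h.map_iInf_iterate⟩, fun X hX =>
      h.le_iInf_iterate ⟨hX.1, hX.2.1⟩ hX.2.2.symm.le⟩
  have hex : ∃ X, IsGreatest {X : State N → ℝ≥0∞ | Measurable X ∧ (∀ σ, X σ ≤ 1) ∧ T X = X} X :=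
    ⟨_, hg⟩
  rw [gfp, dif_pos hex]
  exact hex.choose_spec.unique hg

theorem gfp_ite (φ : Pred N) (h : IsCocontinuous T) :
    IsCocontinuous (fun f => gfp fun X σ => if φ.eval σ = true then T X σ else f σ) := by
  set Φ : (State N → ℝ≥0∞) → (State N → ℝ≥0∞) → State N → ℝ≥0∞ :=
    fun f X σ => if φ.eval σ = true then T X σ else f σ with hΦ
  have hc : ∀ f, Preexp f → IsCocontinuous (Φ f) := fun f hf => ite φ h (const hf)
  have hn : ∀ n, IsCocontinuous (fun f => (Φ f)^[n] 1) := fun n => by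
    induction n with
    | zero => exact const Preexp.one
    | succ n ih =>
      simp only [Function.iterate_succ_apply']
      exact ite φ (h.comp ih) id
  have hg : ∀ f, Preexp f → gfp (Φ f) = ⨅ n, (Φ f)^[n] 1 := fun f hf => (hc f hf).gfp_eq
  change IsCocontinuous fun f => gfp (Φ f)
  refine ⟨fun {f} hf => ?_, fun {f g} hf hg' hfg => ?_, fun {f} hf ha => ?_⟩
  · rw [hg f hf]; exact Preexp.iInf (hc f hf).iterate
  · rw [hg f hf, hg g hg']; exact iInf_mono fun n => (hn n).mono hf hg' hfg
  · rw [hg _ (Preexp.iInf hf)]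
    simp only [fun n => hg _ (hf n)]
    rw [iInf_comm]
    exact iInf_congr fun n => (hn n).map_iInf hf ha

end IsCocontinuous

section wlp

variable [DecidableEq N]

theorem wlp_ifThen (φ : Pred N) (C : Prog N) (f : State N → ℝ≥0∞) :
    wlp (.ifThen φ C) f = fun σ => if φ.eval σ = true then wlp C f σ else f σ := by
  funext σ; exact iverson_add_iverson _ _ _

theorem wlp_while (φ : Pred N) (C : Prog N) (f : State N → ℝ≥0∞) :
    wlp (.while φ C) f = gfp fun X σ => if φ.eval σ = true then wlp C X σ else f σ := by
  simp only [wlp, iverson_add_iverson']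

theorem wlp_observe (φ : Pred N) (f : State N → ℝ≥0∞) :
    wlp (.observe φ) f = fun σ => if φ.eval σ = true then f σ else 0 := by
  funext σ; exact iverson_mul _ _

theorem wlp_split (C₁ C₂ : Prog N) (f : State N → ℝ≥0∞) :
    wlp (C₁.split C₂).1 (wlp (C₁.split C₂).2 f) = wlp C₁ (wlp C₂ f) := by
  induction C₁ generalizing C₂ with
  | seq A B ihA _ => rw [Prog.split, ihA]; rfl
  | _ => rfl

theorem isCocontinuous_wlp [Countable N] (C : Prog N) : IsCocontinuous (wlp C) := by
  induction C with
  | skip => exact .id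
  | diverge => exact .const Preexp.one
  | assign x E => exact .subst (measurable_update_comp x measurable_id E.measurable_eval)
  | draw x => exact .draw x
  | observe φ =>
    simp only [funext (wlp_observe φ)]
    exact .ite φ .id (.const ⟨measurable_const, fun _ => zero_le⟩)
  | score E => exact .mul ⟨E.measurable_factor, E.factor_le_one⟩
  | seq A B ihA ihB => exact ihA.comp ihB
  | ifThen φ C ih =>
    simp only [funext (wlp_ifThen φ C)]
    exact .ite φ ih .id
  | _ φ C ih =>
    simp only [funext (wlp_while φ C)]
    exact .gfp_ite φ ih

theorem wlp_while_isCocontinuous [Countable N] (φ : Pred N) (C : Prog N)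
    {f : State N → ℝ≥0∞} (hf : Preexp f) :
    IsCocontinuous fun X σ => if φ.eval σ = true then wlp C X σ else f σ :=
  .ite φ (isCocontinuous_wlp C) (.const hf)

theorem wlp_while_unfold [Countable N] (φ : Pred N) (C : Prog N) {f : State N → ℝ≥0∞}
    (hf : Preexp f) : wlp (.while φ C) f =
      fun σ => if φ.eval σ = true then wlp C (wlp (.while φ C) f) σ else f σ := by
  have h := wlp_while_isCocontinuous φ C hf
  have := h.map_iInf_iterate
  rw [← h.gfp_eq, ← wlp_while] at this
  exact this.symm

theorem le_wlp_while [Countable N] (φ : Pred N) (C : Prog N) {f X : State N → ℝ≥0∞}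
    (hf : Preexp f) (hX : Preexp X)
    (hle : ∀ σ, X σ ≤ if φ.eval σ = true then wlp C X σ else f σ) : X ≤ wlp (.while φ C) f := by
  have h := wlp_while_isCocontinuous φ C hf
  rw [wlp_while, h.gfp_eq]
  exact h.le_iInf_iterate hX hle

end wlp

end PL

end

noncomputable section

namespace PL

open MeasureTheory

variable {N : Type*} [DecidableEq N]

/-! ### Liberal step-bounded payoffs -/

section payoff

variable {S : Type*} [MeasurableSpace S]

/-- The payoff of a run of at most `n` steps: the product of the scores of these steps, times
`f τ` if the run is completed in state `τ`, times `0` if it is stuck or has failed, and times `1`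
if it is still going on. -/
def payoff (Θ : EntropySpace S) (f : State N → ℝ≥0∞) :
    ℕ → Prog N → List (Prog N) → S → S → State N → ℝ≥0∞
  | 0, .skip, [], _, _, σ => f σ
  | 0, _, _, _, _, _ => 1
  | _ + 1, .skip, [], _, _, σ => f σ
  | n + 1, .skip, C :: K, _, θK, σ => payoff Θ f n C K (Θ.πL θK) (Θ.πR θK) σ
  | n + 1, .diverge, K, θ, θK, σ => payoff Θ f n .diverge K θ θK σ
  | n + 1, .assign x E, K, θ, θK, σ => payoff Θ f n .skip K θ θK (σ.update x (E.eval σ))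
  | n + 1, .draw x, K, θ, θK, σ =>
      payoff Θ f n .skip K (Θ.πR θ) θK (σ.update x (Θ.πU (Θ.πL θ)))
  | n + 1, .observe φ, K, θ, θK, σ =>
      if φ.eval σ = true then payoff Θ f n .skip K θ θK σ else 0
  | n + 1, .score E, K, θ, θK, σ => E.factor σ * payoff Θ f n .skip K θ θK σ
  | n + 1, .seq C₁ C₂, K, θ, θK, σ =>
      payoff Θ f n (C₁.split C₂).1 ((C₁.split C₂).2 :: K) (Θ.πL θ) (Θ.pair (Θ.πR θ) θK) σ
  | n + 1, .ifThen φ C, K, θ, θK, σ =>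
      if φ.eval σ = true then payoff Θ f n C K θ θK σ else payoff Θ f n .skip K θ θK σ
  | n + 1, .while φ C, K, θ, θK, σ =>
      if φ.eval σ = true then payoff Θ f n (.seq C (.while φ C)) K θ θK σ
      else payoff Θ f n .skip K θ θK σ

/-- The expected payoff of a run of at most `n` steps. -/
def expPayoff (f : State N → ℝ≥0∞) : ℕ → Prog N → List (Prog N) → State N → ℝ≥0∞
  | 0, .skip, [], σ => f σ
  | 0, _, _, _ => 1
  | _ + 1, .skip, [], σ => f σ
  | n + 1, .skip, C :: K, σ => expPayoff f n C K σ
  | n + 1, .diverge, K, σ => expPayoff f n .diverge K σ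
  | n + 1, .assign x E, K, σ => expPayoff f n .skip K (σ.update x (E.eval σ))
  | n + 1, .draw x, K, σ => ∫⁻ v : unitInterval, expPayoff f n .skip K (σ.update x v)
  | n + 1, .observe φ, K, σ => if φ.eval σ = true then expPayoff f n .skip K σ else 0
  | n + 1, .score E, K, σ => E.factor σ * expPayoff f n .skip K σ
  | n + 1, .seq C₁ C₂, K, σ => expPayoff f n (C₁.split C₂).1 ((C₁.split C₂).2 :: K) σ
  | n + 1, .ifThen φ C, K, σ =>
      if φ.eval σ = true then expPayoff f n C K σ else expPayoff f n .skip K σ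
  | n + 1, .while φ C, K, σ =>
      if φ.eval σ = true then expPayoff f n (.seq C (.while φ C)) K σ
      else expPayoff f n .skip K σ

variable {Θ : EntropySpace S} {f : State N → ℝ≥0∞}

theorem payoff_zero (C : Prog N) (K : List (Prog N)) (θ θK : S) (σ : State N) :
    (C = .skip ∧ K = [] ∧ payoff Θ f 0 C K θ θK σ = f σ) ∨
      (¬ (C = .skip ∧ K = []) ∧ payoff Θ f 0 C K θ θK σ = 1) := by
  cases C <;> cases K <;> simp [payoff]

theorem expPayoff_zero (C : Prog N) (K : List (Prog N)) (σ : State N) :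
    (C = .skip ∧ K = [] ∧ expPayoff f 0 C K σ = f σ) ∨
      (¬ (C = .skip ∧ K = []) ∧ expPayoff f 0 C K σ = 1) := by
  cases C <;> cases K <;> simp [expPayoff]

theorem payoff_skip_nil (n : ℕ) (θ θK : S) (σ : State N) :
    payoff Θ f n .skip [] θ θK σ = f σ := by
  cases n <;> rfl

theorem expPayoff_skip_nil (n : ℕ) (σ : State N) : expPayoff f n .skip [] σ = f σ := by
  cases n <;> rfl

theorem payoff_le_one (hf : ∀ σ, f σ ≤ 1) (n : ℕ) (C : Prog N) (K : List (Prog N)) (θ θK : S)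
    (σ : State N) : payoff Θ f n C K θ θK σ ≤ 1 := by
  induction n generalizing C K θ θK σ with
  | zero =>
    rcases payoff_zero (Θ := Θ) (f := f) C K θ θK σ with ⟨-, -, h⟩ | ⟨-, h⟩ <;> rw [h]
    exact hf σ
  | succ n ih =>
    cases C with
    | skip => cases K <;> simp only [payoff, hf, ih]
    | score E => exact mul_le_one' (E.factor_le_one σ) (ih ..)
    | _ => simp only [payoff]; first | exact ih .. | (split_ifs <;> simp only [ih, zero_le])

theorem payoff_succ_le (hf : ∀ σ, f σ ≤ 1) (n : ℕ) (C : Prog N) (K : List (Prog N)) (θ θK : S)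
    (σ : State N) : payoff Θ f (n + 1) C K θ θK σ ≤ payoff Θ f n C K θ θK σ := by
  induction n generalizing C K θ θK σ with
  | zero =>
    rcases payoff_zero (Θ := Θ) (f := f) C K θ θK σ with ⟨rfl, rfl, -⟩ | ⟨-, h⟩
    · rfl
    · rw [h]; exact payoff_le_one hf ..
  | succ n ih =>
    cases C with
    | skip => cases K <;> simp only [payoff, le_refl, ih]
    | score E => exact mul_le_mul_right (ih ..) _
    | observe φ => exact ite_le_ite_of_le (ih ..) le_rfl
    | diverge | assign | draw | seq => exact ih ..
    | _ => exact ite_le_ite_of_le (ih ..) (ih ..)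

theorem antitone_payoff (hf : ∀ σ, f σ ≤ 1) (C : Prog N) (K : List (Prog N)) (θ θK : S)
    (σ : State N) : Antitone fun n => payoff Θ f n C K θ θK σ :=
  antitone_nat_of_succ_le fun n => payoff_succ_le hf n C K θ θK σ

theorem expPayoff_le_one (hf : ∀ σ, f σ ≤ 1) (n : ℕ) (C : Prog N) (K : List (Prog N))
    (σ : State N) : expPayoff f n C K σ ≤ 1 := by
  induction n generalizing C K σ with
  | zero =>
    rcases expPayoff_zero (f := f) C K σ with ⟨-, -, h⟩ | ⟨-, h⟩ <;> rw [h]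
    exact hf σ
  | succ n ih =>
    cases C with
    | skip => cases K <;> simp only [expPayoff, hf, ih]
    | score E => exact mul_le_one' (E.factor_le_one σ) (ih ..)
    | draw x => exact (lintegral_mono fun v => ih ..).trans (by simp)
    | _ => simp only [expPayoff]; first | exact ih .. | (split_ifs <;> simp only [ih, zero_le])

theorem expPayoff_succ_le (hf : ∀ σ, f σ ≤ 1) (n : ℕ) (C : Prog N) (K : List (Prog N))
    (σ : State N) : expPayoff f (n + 1) C K σ ≤ expPayoff f n C K σ := by
  induction n generalizing C K σ with
  | zero =>
    rcases expPayoff_zero (f := f) C K σ with ⟨rfl, rfl, -⟩ | ⟨-, h⟩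
    · rfl
    · rw [h]; exact expPayoff_le_one hf ..
  | succ n ih =>
    cases C with
    | skip => cases K <;> simp only [expPayoff, le_refl, ih]
    | score E => exact mul_le_mul_right (ih ..) _
    | draw x => exact lintegral_mono fun v => ih ..
    | observe φ => exact ite_le_ite_of_le (ih ..) le_rfl
    | diverge | assign | seq => exact ih ..
    | _ => exact ite_le_ite_of_le (ih ..) (ih ..)

theorem measurable_payoff [Countable N] (hf : Measurable f) (n : ℕ) (C : Prog N)
    (K : List (Prog N)) :
    Measurable fun p : S × S × State N => payoff Θ f n C K p.1 p.2.1 p.2.2 := by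
  have hL := Θ.measurable_πL
  have hR := Θ.measurable_πR
  have hite : ∀ (φ : Pred N) {g h : S × S × State N → ℝ≥0∞}, Measurable g → Measurable h →
      Measurable fun p => if φ.eval p.2.2 = true then g p else h p := fun φ g h hg hh =>
    Measurable.ite ((measurable_snd.comp measurable_snd) φ.measurableSet) hg hh
  induction n generalizing C K with
  | zero =>
    by_cases h : C = .skip ∧ K = []
    · obtain ⟨rfl, rfl⟩ := h
      exact hf.comp (measurable_snd.comp measurable_snd)
    · have : ∀ p : S × S × State N, payoff Θ f 0 C K p.1 p.2.1 p.2.2 = 1 := fun p => by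
        rcases payoff_zero (Θ := Θ) (f := f) C K p.1 p.2.1 p.2.2 with h' | h'
        exacts [absurd ⟨h'.1, h'.2.1⟩ h, h'.2]
      simp only [this, measurable_const]
  | succ n ih =>
    have ihc : ∀ (C : Prog N) (K : List (Prog N)) {a b : S × S × State N → S}
        {c : S × S × State N → State N}, Measurable a → Measurable b → Measurable c →
        Measurable fun p => payoff Θ f n C K (a p) (b p) (c p) := fun C K a b c ha hb hc =>
      (ih C K).comp (ha.prodMk (hb.prodMk hc))
    have m2 : Measurable fun p : S × S × State N => p.2.1 := measurable_fst.comp measurable_snd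
    have m3 : Measurable fun p : S × S × State N => p.2.2 := measurable_snd.comp measurable_snd
    cases C with
    | skip =>
      cases K with
      | nil => exact hf.comp m3
      | cons C K => exact ihc C K (hL.comp m2) (hR.comp m2) m3
    | diverge => exact ih _ _
    | assign x E =>
      exact ihc _ _ measurable_fst m2
        (measurable_update_comp x m3 (E.measurable_eval.comp m3))
    | draw x =>
      exact ihc _ _ (hR.comp measurable_fst) m2 (measurable_update_comp x m3
        (measurable_subtype_coe.comp (Θ.measurable_πU.comp (hL.comp measurable_fst))))
    | observe φ => exact hite φ (ih _ _) measurable_const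
    | score E => exact (E.measurable_factor.comp m3).mul (ih _ _)
    | seq A B =>
      exact ihc _ _ (hL.comp measurable_fst)
        (Θ.measurable_pair.comp ((hR.comp measurable_fst).prodMk m2)) m3
    | ifThen φ C => exact hite φ (ih _ _) (ih _ _)
    | _ φ C => exact hite φ (ih _ _) (ih _ _)

theorem measurable_payoff_left [Countable N] (hf : Measurable f) (n : ℕ) (C : Prog N)
    (K : List (Prog N)) (θK : S) (σ : State N) :
    Measurable fun θ => payoff Θ f n C K θ θK σ :=
  (measurable_payoff hf n C K).comp
    (measurable_id.prodMk (measurable_const (a := (θK, σ))))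

theorem preexp_expPayoff [Countable N] (hf : Preexp f) (n : ℕ) (C : Prog N)
    (K : List (Prog N)) : Preexp (expPayoff f n C K) := by
  refine ⟨?_, expPayoff_le_one hf.2 n C K⟩
  have hite : ∀ (φ : Pred N) {g h : State N → ℝ≥0∞}, Measurable g → Measurable h →
      Measurable fun p => if φ.eval p = true then g p else h p := fun φ g h hg hh =>
    Measurable.ite φ.measurableSet hg hh
  induction n generalizing C K with
  | zero =>
    by_cases h : C = .skip ∧ K = []
    · obtain ⟨rfl, rfl⟩ := h
      exact hf.1
    · have : expPayoff f 0 C K = fun _ => 1 := funext fun σ => by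
        rcases expPayoff_zero (f := f) C K σ with h' | h'
        exacts [absurd ⟨h'.1, h'.2.1⟩ h, h'.2]
      rw [this]; exact measurable_const
  | succ n ih =>
    cases C with
    | skip =>
      cases K with
      | nil => exact hf.1
      | cons C K => exact ih C K
    | diverge => exact ih _ _
    | assign x E => exact (ih _ _).comp (measurable_update_comp x measurable_id E.measurable_eval)
    | draw x =>
      exact ((IsCocontinuous.draw x).preexp ⟨ih _ _, expPayoff_le_one hf.2 n .skip K⟩).1
    | observe φ => exact hite φ (ih _ _) measurable_const
    | score E => exact E.measurable_factor.mul (ih _ _)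
    | seq A B => exact ih _ _
    | ifThen φ C => exact hite φ (ih _ _) (ih _ _)
    | _ φ C => exact hite φ (ih _ _) (ih _ _)

/-! ### Integrating out the entropy -/

theorem lintegral_pair (Θ : EntropySpace S) {h : S → ℝ≥0∞} (hh : Measurable h) :
    ∫⁻ θR, ∫⁻ θL, h (Θ.pair θL θR) ∂Θ.μ ∂Θ.μ = ∫⁻ θ, h θ ∂Θ.μ := by
  rw [← Θ.lintegral_πL_πR (fun p => h (Θ.pair p.1 p.2)) (hh.comp Θ.measurable_pair)]
  refine lintegral_congr fun θ => ?_
  obtain ⟨a, b, rfl⟩ := Θ.pair_surjective θ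
  simp only [Θ.πL_pair, Θ.πR_pair]

theorem lintegral_payoff [Countable N] (Θ : EntropySpace S) (hf : Measurable f) (n : ℕ)
    (C : Prog N) (K : List (Prog N)) (σ : State N) :
    ∫⁻ θK, ∫⁻ θ, payoff Θ f n C K θ θK σ ∂Θ.μ ∂Θ.μ = expPayoff f n C K σ := by
  have : IsProbabilityMeasure Θ.μ := ⟨Θ.measure_univ⟩
  have hm : ∀ (C : Prog N) (K : List (Prog N)) (σ : State N),
      Measurable fun p : S × S => payoff Θ f n C K p.1 p.2 σ := fun C K σ =>
    (measurable_payoff hf n C K).comp (measurable_fst.prodMk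
      (measurable_snd.prodMk measurable_const))
  induction n generalizing C K σ with
  | zero =>
    rcases expPayoff_zero (f := f) C K σ with ⟨rfl, rfl, -⟩ | ⟨hn, h⟩
    · simp [payoff, expPayoff]
    · have : ∀ θ θK, payoff Θ f 0 C K θ θK σ = 1 := fun θ θK => by
        rcases payoff_zero (Θ := Θ) (f := f) C K θ θK σ with h' | h'
        exacts [absurd ⟨h'.1, h'.2.1⟩ hn, h'.2]
      simp [this, h]
  | succ n ih =>
    replace hm : ∀ (C : Prog N) (K : List (Prog N)) (σ : State N),
        Measurable fun p : S × S => payoff Θ f n C K p.1 p.2 σ := fun C K σ =>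
      (measurable_payoff hf n C K).comp (measurable_fst.prodMk
        (measurable_snd.prodMk measurable_const))
    replace ih := fun C K σ => ih C K σ (hm)
    cases C with
    | skip =>
      cases K with
      | nil => simp [payoff, expPayoff]
      | cons C K =>
        simp only [payoff, expPayoff, lintegral_const, measure_univ, mul_one]
        rw [Θ.lintegral_πL_πR (fun p => payoff Θ f n C K p.1 p.2 σ) (hm C K σ)]
        exact ih C K σ
    | diverge => exact ih _ _ _
    | assign x E => exact ih _ _ _
    | draw x =>
      simp only [payoff, expPayoff]
      have hu : Measurable fun v : unitInterval => σ.update x v :=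
        measurable_update_comp x measurable_const measurable_subtype_coe
      have hm3 : Measurable fun p : S × S × unitInterval =>
          payoff Θ f n .skip K p.1 p.2.1 (σ.update x p.2.2) :=
        (measurable_payoff hf n .skip K).comp (measurable_fst.prodMk
          ((measurable_fst.comp measurable_snd).prodMk
            (hu.comp (measurable_snd.comp measurable_snd))))
      have h1 : ∀ θK, ∫⁻ θ, payoff Θ f n .skip K (Θ.πR θ) θK
          (σ.update x (Θ.πU (Θ.πL θ))) ∂Θ.μ =
          ∫⁻ v : unitInterval, ∫⁻ θ, payoff Θ f n .skip K θ θK (σ.update x v) ∂Θ.μ := by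
        intro θK
        rw [Θ.lintegral_πL_πR
          (fun p => payoff Θ f n .skip K p.2 θK (σ.update x (Θ.πU p.1)))
          (hm3.comp (measurable_snd.prodMk (measurable_const.prodMk
            (Θ.measurable_πU.comp measurable_fst))))]
        have h2 : ∀ θ, ∫⁻ θL, payoff Θ f n .skip K θ θK (σ.update x (Θ.πU θL)) ∂Θ.μ =
            ∫⁻ v : unitInterval, payoff Θ f n .skip K θ θK (σ.update x v) := fun θ =>
          Θ.lintegral_πU (fun v => payoff Θ f n .skip K θ θK (σ.update x v))
            (hm3.comp (measurable_const.prodMk (measurable_const.prodMk measurable_id)))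
        simp only [h2]
        exact lintegral_lintegral_swap (hm3.comp (measurable_fst.prodMk
          (measurable_const.prodMk measurable_snd))).aemeasurable
      simp only [h1]
      rw [lintegral_lintegral_swap]
      · exact lintegral_congr fun v => ih _ _ _
      · refine Measurable.aemeasurable ?_
        exact Measurable.lintegral_prod_right' (f := fun q : (S × unitInterval) × S =>
            payoff Θ f n .skip K q.2 q.1.1 (σ.update x q.1.2))
          (hm3.comp (measurable_snd.prodMk ((measurable_fst.comp measurable_fst).prodMk
            (measurable_snd.comp measurable_fst))))
    | observe φ =>
      simp only [payoff, expPayoff]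
      split_ifs
      exacts [ih _ _ _, by simp]
    | score E =>
      simp only [payoff, expPayoff]
      have hc : E.factor σ ≠ ⊤ := ne_top_of_le_ne_top ENNReal.one_ne_top (E.factor_le_one σ)
      simp only [lintegral_const_mul' _ _ hc, ih]
    | seq A B =>
      simp only [payoff, expPayoff]
      generalize A.split B = P
      have h1 : ∀ θK, ∫⁻ θ, payoff Θ f n P.1 (P.2 :: K) (Θ.πL θ) (Θ.pair (Θ.πR θ) θK) σ ∂Θ.μ =
          ∫⁻ θR, ∫⁻ θL, payoff Θ f n P.1 (P.2 :: K) θL (Θ.pair θR θK) σ ∂Θ.μ ∂Θ.μ := fun θK =>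
        Θ.lintegral_πL_πR (fun p => payoff Θ f n P.1 (P.2 :: K) p.1 (Θ.pair p.2 θK) σ)
          ((hm P.1 (P.2 :: K) σ).comp (measurable_fst.prodMk
            (Θ.measurable_pair.comp (measurable_snd.prodMk measurable_const))))
      simp only [h1]
      rw [lintegral_pair Θ (h := fun θ => ∫⁻ θL, payoff Θ f n P.1 (P.2 :: K) θL θ σ ∂Θ.μ)
        (hm P.1 (P.2 :: K) σ).lintegral_prod_left']
      exact ih _ _ _
    | ifThen φ C =>
      simp only [payoff, expPayoff]
      split_ifs <;> exact ih _ _ _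
    | _ φ C =>
      simp only [payoff, expPayoff]
      split_ifs <;> exact ih _ _ _

/-- Agreement of the first `m` entries of two continuation entropies. -/
def AgreeUpTo (Θ : EntropySpace S) : ℕ → S → S → Prop
  | 0, _, _ => True
  | m + 1, a, b => Θ.πL a = Θ.πL b ∧ AgreeUpTo Θ m (Θ.πR a) (Θ.πR b)

theorem payoff_congr_contEntropy (n : ℕ) (C : Prog N) (K : List (Prog N)) (θ a b : S)
    (σ : State N) (h : AgreeUpTo Θ K.length a b) :
    payoff Θ f n C K θ a σ = payoff Θ f n C K θ b σ := by
  induction n generalizing C K θ a b σ with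
  | zero => cases C <;> cases K <;> rfl
  | succ n ih =>
    cases C with
    | skip =>
      cases K with
      | nil => rfl
      | cons C K =>
        simp only [payoff]
        rw [h.1]
        exact ih _ _ _ _ _ _ h.2
    | seq A B =>
      refine ih _ _ _ _ _ _ ?_
      simpa [AgreeUpTo, Θ.πL_pair, Θ.πR_pair] using h
    | _ => simp only [payoff, ih _ _ _ _ _ _ h]

theorem lintegral_payoff_nil [Countable N] (Θ : EntropySpace S) (θK : S) (hf : Measurable f)
    (n : ℕ) (C : Prog N) (σ : State N) :
    ∫⁻ θ, payoff Θ f n C [] θ θK σ ∂Θ.μ = expPayoff f n C [] σ := by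
  have : IsProbabilityMeasure Θ.μ := ⟨Θ.measure_univ⟩
  rw [← lintegral_payoff Θ hf]
  simp only [fun θ θ' => payoff_congr_contEntropy (Θ := Θ) (f := f) n C [] θ θ' θK σ trivial,
    lintegral_const, measure_univ, mul_one]

end payoff

/-! ### The limit of the expected payoffs -/

section limit

variable {f : State N → ℝ≥0∞}

/-- The weakest liberal preexpectation of a continuation. -/
def wlpCont (f : State N → ℝ≥0∞) : List (Prog N) → State N → ℝ≥0∞
  | [] => f
  | C :: K => wlp C (wlpCont f K)

theorem preexp_wlpCont [Countable N] (hf : Preexp f) (K : List (Prog N)) :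
    Preexp (wlpCont f K) := by
  induction K with
  | nil => exact hf
  | cons C K ih => exact (isCocontinuous_wlp C).preexp ih

theorem wlp_le_expPayoff [Countable N] (hf : Preexp f) (n : ℕ) (C : Prog N)
    (K : List (Prog N)) (σ : State N) :
    wlp C (wlpCont f K) σ ≤ expPayoff f n C K σ := by
  induction n generalizing C K σ with
  | zero =>
    rcases expPayoff_zero (f := f) C K σ with ⟨rfl, rfl, h⟩ | ⟨-, h⟩
    · exact le_rfl
    · rw [h]; exact ((isCocontinuous_wlp C).preexp (preexp_wlpCont hf K)).2 σ
  | succ n ih =>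
    cases C with
    | skip =>
      cases K with
      | nil => exact le_rfl
      | cons C K => exact ih _ _ _
    | diverge => exact ih .diverge _ _
    | assign x E => exact ih .skip _ _
    | draw x => exact lintegral_mono fun v => ih .skip _ _
    | observe φ =>
      rw [wlp_observe, expPayoff]
      exact ite_le_ite_of_le (ih .skip _ _) le_rfl
    | score E => exact mul_le_mul_right (ih .skip _ _) _
    | seq A B =>
      rw [expPayoff, wlp, ← wlp_split]
      exact ih (A.split B).1 ((A.split B).2 :: K) σ
    | ifThen φ C =>
      rw [wlp_ifThen, expPayoff]
      exact ite_le_ite_of_le (ih _ _ _) (ih .skip _ _)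
    | _ φ C =>
      rw [wlp_while_unfold φ C (preexp_wlpCont hf K), expPayoff]
      exact ite_le_ite_of_le (ih (.seq C (.while φ C)) _ _) (ih .skip _ _)

/-- The limit of the expected payoffs of runs of bounded length. -/
def limPayoff (f : State N → ℝ≥0∞) (C : Prog N) (K : List (Prog N)) : State N → ℝ≥0∞ :=
  ⨅ n, expPayoff f n C K

theorem preexp_limPayoff [Countable N] (hf : Preexp f) (C : Prog N) (K : List (Prog N)) :
    Preexp (limPayoff f C K) :=
  Preexp.iInf fun n => preexp_expPayoff hf n C K

theorem limPayoff_eq_shift (hf : Preexp f) (C : Prog N) (K : List (Prog N)) :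
    limPayoff f C K = ⨅ n, expPayoff f (n + 1) C K := by
  refine le_antisymm (le_iInf fun n => iInf_le _ _) (le_iInf fun n => ?_)
  exact (iInf_le _ n).trans (expPayoff_succ_le hf.2 n C K)

theorem limPayoff_eq_of_succ [Countable N] (hf : Preexp f)
    {T : (State N → ℝ≥0∞) → State N → ℝ≥0∞}
    (hT : IsCocontinuous T) {C C' : Prog N} {K K' : List (Prog N)}
    (h : ∀ n, expPayoff f (n + 1) C K = T (expPayoff f n C' K')) :
    limPayoff f C K = T (limPayoff f C' K') := by
  rw [limPayoff_eq_shift hf, limPayoff, hT.map_iInf (fun n => preexp_expPayoff hf n C' K')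
    (antitone_nat_of_succ_le fun n => expPayoff_succ_le hf.2 n C' K')]
  exact iInf_congr h

theorem limPayoff_skip_nil : limPayoff f .skip [] = f := by
  simp only [limPayoff, funext (expPayoff_skip_nil (f := f) _), ciInf_const]

theorem limPayoff_skip_cons [Countable N] (hf : Preexp f) (C : Prog N) (K : List (Prog N)) :
    limPayoff f .skip (C :: K) = limPayoff f C K :=
  limPayoff_eq_of_succ hf .id fun _ => rfl

theorem limPayoff_seq [Countable N] (hf : Preexp f) (A B : Prog N) (K : List (Prog N)) :
    limPayoff f (.seq A B) K = limPayoff f (A.split B).1 ((A.split B).2 :: K) :=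
  limPayoff_eq_of_succ hf .id fun _ => rfl

theorem limPayoff_ite_apply (hf : Preexp f) {φ : Pred N} {C C' : Prog N} {K : List (Prog N)}
    (h : ∀ n, expPayoff f (n + 1) C K = fun σ =>
      if φ.eval σ = true then expPayoff f n C' K σ else expPayoff f n .skip K σ) (σ : State N) :
    limPayoff f C K σ =
      if φ.eval σ = true then limPayoff f C' K σ else limPayoff f .skip K σ := by
  rw [limPayoff_eq_shift hf]
  simp only [limPayoff, iInf_apply, h]
  split_ifs <;> rfl

/-- The two bounds that are proved together by induction on programs: one for `C` with a
continuation and one for a sequence that starts with `C`. -/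
theorem limPayoff_le_wlp_limPayoff [Countable N] (hf : Preexp f) (C : Prog N) :
    (∀ K, limPayoff f C K ≤ wlp C (limPayoff f .skip K)) ∧
      ∀ B K, limPayoff f (.seq C B) K ≤ wlp C (limPayoff f B K) := by
  have key : ∀ C : Prog N, (∀ B, C.split B = (C, B)) →
      (∀ K, limPayoff f C K ≤ wlp C (limPayoff f .skip K)) →
      (∀ K, limPayoff f C K ≤ wlp C (limPayoff f .skip K)) ∧
        ∀ B K, limPayoff f (.seq C B) K ≤ wlp C (limPayoff f B K) := by
    intro C hs h
    refine ⟨h, fun B K => ?_⟩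
    rw [limPayoff_seq hf, hs, ← limPayoff_skip_cons hf B K]
    exact h _
  induction C with
  | skip => exact key _ (fun _ => rfl) fun K => le_rfl
  | diverge => exact key _ (fun _ => rfl) fun K => (preexp_limPayoff hf _ K).2
  | assign x E =>
    exact key _ (fun _ => rfl) fun K =>
      (limPayoff_eq_of_succ hf (isCocontinuous_wlp (.assign x E)) fun _ => rfl).le
  | draw x =>
    exact key _ (fun _ => rfl) fun K =>
      (limPayoff_eq_of_succ hf (isCocontinuous_wlp (.draw x)) fun _ => rfl).le
  | observe φ =>
    exact key _ (fun _ => rfl) fun K =>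
      (limPayoff_eq_of_succ hf (isCocontinuous_wlp (.observe φ)) fun _ => by
        rw [wlp_observe]; rfl).le
  | score E =>
    exact key _ (fun _ => rfl) fun K =>
      (limPayoff_eq_of_succ hf (isCocontinuous_wlp (.score E)) fun _ => rfl).le
  | seq A B ihA ihB =>
    have hA := isCocontinuous_wlp A
    have hp := fun C K => preexp_limPayoff hf C K
    refine ⟨fun K => (ihA.2 B K).trans ?_, fun D K => ?_⟩
    · exact hA.mono (hp _ _) ((isCocontinuous_wlp B).preexp (hp _ _)) (ihB.1 K)
    · have : limPayoff f (.seq (.seq A B) D) K = limPayoff f (.seq A (.seq B D)) K := by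
        rw [limPayoff_seq hf, limPayoff_seq hf]; rfl
      rw [this]
      exact (ihA.2 _ K).trans
        (hA.mono (hp _ _) ((isCocontinuous_wlp B).preexp (hp _ _)) (ihB.2 D K))
  | ifThen φ C ih =>
    refine key _ (fun _ => rfl) fun K σ => ?_
    rw [wlp_ifThen, limPayoff_ite_apply hf (φ := φ) (C' := C) fun n => rfl]
    exact ite_le_ite_of_le (ih.1 K σ) le_rfl
  | _ φ C ih =>
    refine key _ (fun _ => rfl) fun K => ?_
    refine le_wlp_while φ C (preexp_limPayoff hf _ _) (preexp_limPayoff hf _ _) fun σ => ?_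
    rw [limPayoff_ite_apply hf (φ := φ) (C' := .seq C (.while φ C)) fun n => rfl]
    exact ite_le_ite_of_le (ih.2 _ K σ) le_rfl

theorem iInf_expPayoff_nil [Countable N] (hf : Preexp f) (C : Prog N) (σ : State N) :
    ⨅ n, expPayoff f n C [] σ = wlp C f σ := by
  refine le_antisymm ?_ (le_iInf fun n => wlp_le_expPayoff hf n C [] σ)
  have := (limPayoff_le_wlp_limPayoff hf C).1 [] σ
  rwa [limPayoff_skip_nil, limPayoff, iInf_apply] at this

end limit

end PL

end

noncomputable section

namespace PL

open MeasureTheory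

variable {N : Type*} [DecidableEq N]

/-! ### Payoffs and the reduction relation -/

section operational

variable {S : Type*} [MeasurableSpace S] {Θ : EntropySpace S} {f : State N → ℝ≥0∞}

/-- The payoff of the next `n` steps from a configuration. -/
def Config.payoff (Θ : EntropySpace S) (f : State N → ℝ≥0∞) (n : ℕ) (κ : Config N S) : ℝ≥0∞ :=
  match κ.state with
  | .proper σ => PL.payoff Θ f n κ.stmt κ.cont κ.entropy κ.contEntropy σ
  | _ => 0

theorem Step.weight_mul_payoff {κ κ' : Config N S} (h : Step Θ κ κ') (n : ℕ) :
    κ.weight * κ.payoff Θ f (n + 1) = κ'.weight * κ'.payoff Θ f n := by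
  cases h with
  | score θ E K σ θK n w h =>
    simp only [Config.payoff, PL.payoff, Expr.factor, iverson, if_pos h, one_mul,
      ENNReal.coe_mul, mul_assoc]
    rfl
  | final => simp only [Config.payoff, payoff_skip_nil]
  | _ => simp_all [Config.payoff, PL.payoff]

theorem Step.steps_eq {κ κ' : Config N S} (h : Step Θ κ κ') : κ'.steps = κ.steps + 1 := by
  cases h <;> rfl

theorem Step.weight_ne_zero {κ κ' : Config N S} (h : Step Θ κ κ') (hw : κ.weight ≠ 0) :
    κ'.weight ≠ 0 := by
  cases h with
  | score θ E K σ θK n w h => exact mul_ne_zero hw (Real.toNNReal_pos.2 h.1).ne'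
  | _ => exact hw

theorem Step.state_ne_fail {κ κ' : Config N S} (h : Step Θ κ κ') : κ.state ≠ .fail := by
  cases h <;> simp

theorem Step.state_ne_div {κ κ' : Config N S} (h : Step Θ κ κ') : κ'.state ≠ .div := by
  cases h <;> simp

theorem Step.iterate_contEntropy {κ κ' : Config N S} (h : Step Θ κ κ') (hf : κ'.state ≠ .fail) :
    Θ.πR^[κ'.cont.length] κ'.contEntropy = Θ.πR^[κ.cont.length] κ.contEntropy := by
  cases h <;> simp_all [Θ.πR_pair]

theorem Config.payoff_of_irreducible {κ : Config N S} (h : ∀ κ', ¬ Step Θ κ κ') (n : ℕ) :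
    κ.payoff Θ f (n + 1) = 0 := by
  obtain ⟨θ, C, K, s, θK, k, w⟩ := κ
  cases s with
  | fail => rfl
  | div => rfl
  | proper σ =>
    cases C with
    | skip =>
      cases K with
      | nil => exact absurd (.final ..) (h _)
      | cons C K => exact absurd (.pop ..) (h _)
    | diverge => exact absurd (.diverge ..) (h _)
    | assign x E => exact absurd (.assign ..) (h _)
    | draw x => exact absurd (.draw ..) (h _)
    | observe φ =>
      by_cases hφ : φ.eval σ = true
      · exact absurd (.observe_true _ _ _ _ _ _ _ hφ) (h _)
      · exact absurd (.observe_false _ _ _ _ _ _ _ (by simpa using hφ)) (h _)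
    | score E =>
      by_cases hE : E.eval σ ∈ Set.Ioc (0 : ℝ) 1
      · exact absurd (.score _ _ _ _ _ _ _ hE) (h _)
      · simp only [Config.payoff, PL.payoff, Expr.factor, iverson, if_neg hE, zero_mul]
    | seq A B => exact absurd (.seq ..) (h _)
    | ifThen φ C =>
      by_cases hφ : φ.eval σ = true
      · exact absurd (.if_true _ _ _ _ _ _ _ _ hφ) (h _)
      · exact absurd (.if_false _ _ _ _ _ _ _ _ (by simpa using hφ)) (h _)
    | _ φ C =>
      by_cases hφ : φ.eval σ = true
      · exact absurd (.while_true _ _ _ _ _ _ _ _ hφ) (h _)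
      · exact absurd (.while_false _ _ _ _ _ _ _ _ (by simpa using hφ)) (h _)

section run

variable {θK θ : S} {C : Prog N} {σ : State N} {κ : Config N S}

theorem Steps.payoff_eq (h : Steps Θ (Config.init θK C (.proper σ) θ) κ) (f : State N → ℝ≥0∞)
    (m : ℕ) : payoff Θ f (κ.steps + m) C [] θ θK σ = κ.weight * κ.payoff Θ f m := by
  induction h generalizing m with
  | refl => simp [Config.init, Config.payoff]
  | tail _ h ih =>
    rw [h.steps_eq, add_assoc, add_comm 1 m, ih, h.weight_mul_payoff]

theorem Steps.weight_ne_zero (h : Steps Θ (Config.init θK C (.proper σ) θ) κ) :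
    κ.weight ≠ 0 := by
  induction h with
  | refl => exact one_ne_zero
  | tail _ h ih => exact h.weight_ne_zero ih

theorem Steps.iterate_contEntropy (h : Steps Θ (Config.init θK C (.proper σ) θ) κ)
    (hf : κ.state ≠ .fail) : Θ.πR^[κ.cont.length] κ.contEntropy = θK := by
  induction h with
  | refl => rfl
  | tail _ h ih => rw [h.iterate_contEntropy hf, ih h.state_ne_fail]

theorem Steps.state_ne_div (h : Steps Θ (Config.init θK C (.proper σ) θ) κ) :
    κ.state ≠ .div := by
  induction h with
  | refl => simp [Config.init]
  | tail _ h ih => exact h.state_ne_div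

theorem exists_steps_or_irreducible (Θ : EntropySpace S) (θK θ : S) (C : Prog N) (σ : State N)
    (n : ℕ) : (∃ κ, Steps Θ (Config.init θK C (.proper σ) θ) κ ∧ κ.steps = n) ∨
      ∃ κ, Steps Θ (Config.init θK C (.proper σ) θ) κ ∧ κ.steps < n ∧ ∀ κ', ¬ Step Θ κ κ' := by
  induction n with
  | zero => exact .inl ⟨_, .refl, rfl⟩
  | succ n ih =>
    rcases ih with ⟨κ, hκ, hn⟩ | ⟨κ, hκ, hn, hi⟩
    · by_cases h : ∃ κ', Step Θ κ κ'
      · obtain ⟨κ', h⟩ := h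
        exact .inl ⟨κ', hκ.tail h, by rw [h.steps_eq, hn]⟩
      · exact .inr ⟨κ, hκ, by omega, not_exists.1 h⟩
    · exact .inr ⟨κ, hκ, by omega, hi⟩

theorem Steps.payoff_eq_zero (h : Steps Θ (Config.init θK C (.proper σ) θ) κ)
    (hi : ∀ κ', ¬ Step Θ κ κ') (f : State N → ℝ≥0∞) {n : ℕ} (hn : κ.steps < n) :
    payoff Θ f n C [] θ θK σ = 0 := by
  obtain ⟨m, rfl⟩ := Nat.exists_eq_add_of_lt hn
  rw [add_assoc, h.payoff_eq, Config.payoff_of_irreducible hi, mul_zero]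

theorem Config.payoff_one_zero {κ : Config N S} {τ : State N} (h : κ.state = .proper τ) :
    κ.payoff Θ 1 0 = 1 := by
  simp only [Config.payoff, h]
  rcases payoff_zero (Θ := Θ) (f := 1) κ.stmt κ.cont κ.entropy κ.contEntropy τ with h | h
  exacts [h.2.2, h.2]

theorem coe_scoreAt (Θ : EntropySpace S) (θK θ : S) (C : Prog N) (σ : State N) (n : ℕ) :
    (scoreAt Θ θK C (.proper σ) θ n : ℝ≥0∞) = payoff Θ 1 n C [] θ θK σ := by
  rw [scoreAt]
  split_ifs with h
  · obtain ⟨hs, hn, hf⟩ := h.choose_spec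
    have hd := Steps.state_ne_div hs
    generalize h.choose = κ at hs hn hf hd ⊢
    cases hκ : κ.state with
    | fail => exact absurd hκ hf
    | div => exact absurd hκ hd
    | proper τ =>
      have := Steps.payoff_eq hs 1 0
      rw [hn, add_zero, Config.payoff_one_zero hκ, mul_one] at this
      exact this.symm
  · rcases exists_steps_or_irreducible Θ θK θ C σ n with ⟨κ, hκ, hn⟩ | ⟨κ, hκ, hn, hi⟩
    · have hf : κ.state = .fail := by
        by_contra hf
        exact h ⟨κ, hκ, hn, hf⟩
      have := Steps.payoff_eq hκ 1 0
      rw [hn, add_zero] at this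
      simp [this, Config.payoff, hf]
    · simp [Steps.payoff_eq_zero hκ hi 1 hn]

end run

theorem coe_finalScore (Θ : EntropySpace S) (θK θ : S) (C : Prog N) (σ : State N) :
    (finalScore Θ θK C (.proper σ) θ : ℝ≥0∞) = ⨅ n, payoff Θ 1 n C [] θ θK σ := by
  simp only [finalScore, ENNReal.coe_iInf, coe_scoreAt]

/-- The payoffs of a run, in terms of its final state. -/
inductive PayoffSpec (Θ : EntropySpace S) (θK θ : S) (C : Prog N) (σ : State N) :
    ExtState N → Prop
  | proper (τ : State N) (n : ℕ) (w : ℝ≥0) (hw : w ≠ 0)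
      (h : ∀ f m, n ≤ m → payoff Θ f m C [] θ θK σ = w * f τ) : PayoffSpec Θ θK θ C σ (.proper τ)
  | fail (n : ℕ) (h : ∀ f, payoff Θ f n C [] θ θK σ = 0) : PayoffSpec Θ θK θ C σ .fail
  | div (w : ℕ → ℝ≥0) (hw : ∀ n, w n ≠ 0) (h : ∀ f n, payoff Θ f n C [] θ θK σ = w n) :
      PayoffSpec Θ θK θ C σ .div

theorem payoffSpec_finalState (Θ : EntropySpace S) (θK θ : S) (C : Prog N) (σ : State N) :
    PayoffSpec Θ θK θ C σ (finalState Θ θK C (.proper σ) θ) := by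
  simp only [finalState]
  split_ifs with h h'
  · obtain ⟨θ', n, w, hs⟩ := h.choose_spec
    refine .proper _ n w (Steps.weight_ne_zero hs) fun f m hm => ?_
    obtain ⟨k, rfl⟩ := Nat.exists_eq_add_of_le hm
    refine (Steps.payoff_eq hs f k).trans ?_
    simp only [Config.payoff, payoff_skip_nil]
  · obtain ⟨κ, hκ, hi⟩ := h'
    exact .fail (κ.steps + 1) fun f => Steps.payoff_eq_zero hκ hi f (Nat.lt_succ_self _)
  · have hex : ∀ n, ∃ w : ℝ≥0, w ≠ 0 ∧
        ∀ f : State N → ℝ≥0∞, payoff Θ f n C [] θ θK σ = w := by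
      intro n
      rcases exists_steps_or_irreducible Θ θK θ C σ n with ⟨κ, hκ, rfl⟩ | ⟨κ, hκ, -, hi⟩
      · refine ⟨κ.weight, Steps.weight_ne_zero hκ, fun f => ?_⟩
        have hp := Steps.payoff_eq hκ f 0
        rw [add_zero] at hp
        rw [hp]
        have hd := Steps.state_ne_div hκ
        have hE := Steps.iterate_contEntropy hκ
        obtain ⟨κ₁, hstep⟩ : ∃ κ₁, Step Θ κ κ₁ := by
          by_contra hi
          exact h' ⟨κ, hκ, not_exists.1 hi⟩
        have hf := hstep.state_ne_fail
        obtain ⟨a, D, K, s, b, k, w⟩ := κ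
        cases s with
        | fail => exact absurd rfl hf
        | div => exact absurd rfl hd
        | proper τ =>
          rcases payoff_zero (Θ := Θ) (f := f) D K a b τ with ⟨rfl, rfl, -⟩ | ⟨-, h1⟩
          · have : b = θK := hE hf
            subst this
            exact absurd ⟨τ, a, k, w, hκ⟩ h
          · simp only [Config.payoff, h1, mul_one]
      · exact absurd ⟨κ, hκ, hi⟩ h'
    choose w hw hp using hex
    exact .div w hw fun f n => hp n f

/-! ### Measurability of the final state and of the final score -/

theorem measurable_finalScore [Countable N] (Θ : EntropySpace S) (θK : S) (C : Prog N)
    (σ : State N) :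
    Measurable fun θ => (finalScore Θ θK C (.proper σ) θ : ℝ≥0∞) := by
  simp only [coe_finalScore]
  exact Measurable.iInf fun n => measurable_payoff_left measurable_one n C [] θK σ

theorem finalState_eq_fail_iff (Θ : EntropySpace S) (θK θ : S) (C : Prog N) (σ : State N) :
    finalState Θ θK C (.proper σ) θ = .fail ↔ ∃ n, payoff Θ 1 n C [] θ θK σ = 0 := by
  have hs := payoffSpec_finalState Θ θK θ C σ
  generalize finalState Θ θK C (.proper σ) θ = s at hs
  cases hs with
  | proper τ n w hw h =>
    simp only [reduceCtorEq, false_iff, not_exists]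
    intro m hm
    have := antitone_payoff (Θ := Θ) (f := 1) (fun _ => le_rfl) C [] θ θK σ (le_max_left m n)
    simp [h 1 _ (le_max_right m n), hm, hw] at this
  | fail n h => exact ⟨fun _ => ⟨n, h 1⟩, fun _ => rfl⟩
  | div w hw h => simp [h, hw]

theorem finalState_mem_image_proper_iff (Θ : EntropySpace S) (θK θ : S) (C : Prog N)
    (σ : State N) (B : Set (State N)) :
    finalState Θ θK C (.proper σ) θ ∈ ExtState.proper '' B ↔
      (∃ n, payoff Θ (Bᶜ.indicator 1) n C [] θ θK σ = 0) ∧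
        ¬ ∃ n, payoff Θ 1 n C [] θ θK σ = 0 := by
  rw [← finalState_eq_fail_iff]
  have hs := payoffSpec_finalState Θ θK θ C σ
  generalize finalState Θ θK C (.proper σ) θ = s at hs
  cases hs with
  | proper τ n w hw h =>
    have hle : ∀ ρ : State N, Bᶜ.indicator (1 : State N → ℝ≥0∞) ρ ≤ 1 := fun ρ =>
      Set.indicator_le_self' (fun _ _ => zero_le) ρ
    by_cases hτ : τ ∈ B
    · simp only [Set.mem_image, ExtState.proper.injEq, exists_eq_right, hτ, reduceCtorEq,
        not_false_eq_true, and_true, true_iff]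
      exact ⟨n, by simp [h _ n le_rfl, hτ]⟩
    · simp only [Set.mem_image, ExtState.proper.injEq, exists_eq_right, hτ, reduceCtorEq,
        not_false_eq_true, and_true, false_iff, not_exists]
      intro m hm
      have := antitone_payoff (Θ := Θ) hle C [] θ θK σ (le_max_left m n)
      simp [h _ _ (le_max_right m n), hm, hw, hτ] at this
  | fail n h => simp
  | div w hw h => simp [h, hw]

theorem measurable_finalState [Countable N] (Θ : EntropySpace S) (θK : S) (C : Prog N)
    (σ : State N) :
    Measurable (finalState Θ θK C (.proper σ)) := by
  set O := finalState Θ θK C (.proper σ) with hO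
  have hzero : ∀ g : State N → ℝ≥0∞, Measurable g →
      MeasurableSet {θ | ∃ n, payoff Θ g n C [] θ θK σ = 0} := fun g hg => by
    have : {θ | ∃ n, payoff Θ g n C [] θ θK σ = 0} =
        ⋃ n, (fun θ => payoff Θ g n C [] θ θK σ) ⁻¹' {0} := by ext; simp
    rw [this]
    exact MeasurableSet.iUnion fun n =>
      measurable_payoff_left hg n C [] θK σ (measurableSet_singleton 0)
  have hfail : MeasurableSet {θ | O θ = .fail} := by
    simp only [hO, finalState_eq_fail_iff]
    exact hzero 1 measurable_one
  have hproper : ∀ B : Set (State N), MeasurableSet B →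
      MeasurableSet {θ | O θ ∈ ExtState.proper '' B} := fun B hB => by
    simp only [hO, finalState_mem_image_proper_iff]
    exact (hzero _ (measurable_one.indicator hB.compl)).inter (hzero 1 measurable_one).compl
  have hdiv : MeasurableSet {θ | O θ = .div} := by
    have : {θ | O θ = .div} =
        ({θ | O θ = .fail} ∪ {θ | O θ ∈ ExtState.proper '' Set.univ})ᶜ := by
      ext θ
      simp only [Set.mem_ofPred_eq, Set.mem_compl_iff, Set.mem_union]
      cases O θ <;> simp
    rw [this]
    exact (hfail.union (hproper _ .univ)).compl
  intro B hB
  have : O ⁻¹' B = {θ | O θ ∈ ExtState.proper '' (ExtState.proper ⁻¹' B)} ∪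
      ({θ | O θ = .fail} ∩ {_θ | .fail ∈ B}) ∪ ({θ | O θ = .div} ∩ {_θ | .div ∈ B}) := by
    ext θ
    simp only [Set.mem_preimage, Set.mem_union, Set.mem_inter_iff, Set.mem_ofPred_eq]
    cases O θ <;> simp
  rw [this]
  exact ((hproper _ (ExtState.measurableEmbedding_proper.measurable hB)).union
    (hfail.inter (.const _))).union (hdiv.inter (.const _))

/-! ### The theorem -/

theorem lintegral_opMeasureProper [Countable N] (Θ : EntropySpace S) (θK : S) (C : Prog N)
    (σ : State N)
    (hf : Measurable f) :
    ∫⁻ τ, f τ ∂(opMeasureProper Θ θK C (.proper σ)) =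
      ∫⁻ θ, finalScore Θ θK C (.proper σ) θ *
        Function.extend ExtState.proper f 0 (finalState Θ θK C (.proper σ) θ) ∂Θ.μ := by
  have he := ExtState.measurableEmbedding_proper (N := N)
  set F : ExtState N → ℝ≥0∞ := Function.extend ExtState.proper f 0 with hF
  have hFm : Measurable F := he.measurable_extend hf measurable_const
  have hF0 : F = (Set.range ExtState.proper).indicator F := by
    refine (Set.indicator_eq_self.2 fun s hs => ?_).symm
    by_contra hr
    exact hs (Function.extend_apply' _ _ _ hr)
  have hfF : ∀ τ, f τ = F (.proper τ) := fun τ => (he.injective.extend_apply f 0 τ).symm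
  simp only [hfF]
  rw [opMeasureProper, ← he.lintegral_map, he.map_comap,
    ← lintegral_indicator he.measurableSet_range, ← hF0, opMeasure,
    lintegral_map hFm (measurable_finalState Θ θK C σ), entropyMeasure]
  exact lintegral_withDensity_eq_lintegral_mul _ (measurable_finalScore Θ θK C σ)
    (hFm.comp (measurable_finalState Θ θK C σ))

theorem iInf_payoff_eq (Θ : EntropySpace S) (θK θ : S) (C : Prog N) (σ : State N)
    (hf : ∀ τ, f τ ≤ 1) :
    ⨅ n, payoff Θ f n C [] θ θK σ =
      finalScore Θ θK C (.proper σ) θ *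
        Function.extend ExtState.proper f 0 (finalState Θ θK C (.proper σ) θ) +
      iverson (finalState Θ θK C (.proper σ) θ = .div) * finalScore Θ θK C (.proper σ) θ := by
  have hinj := (ExtState.measurableEmbedding_proper (N := N)).injective
  have hext : ∀ s, (∀ τ : State N, ExtState.proper τ ≠ s) →
      Function.extend ExtState.proper f 0 s = 0 := fun s hs =>
    Function.extend_apply' _ _ _ fun ⟨τ, h⟩ => hs τ h
  rw [coe_finalScore]
  have hs := payoffSpec_finalState Θ θK θ C σ
  generalize finalState Θ θK C (.proper σ) θ = s at hs
  cases hs with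
  | proper τ n w hw h =>
    have hinf : ∀ g : State N → ℝ≥0∞, (∀ τ, g τ ≤ 1) →
        ⨅ m, payoff Θ g m C [] θ θK σ = w * g τ := fun g hg => by
      refine le_antisymm ((iInf_le _ n).trans (h g n le_rfl).le) (le_iInf fun m => ?_)
      rw [← h g _ (le_max_right m n)]
      exact antitone_payoff hg C [] θ θK σ (le_max_left m n)
    rw [hinf f hf, hinf 1 fun _ => le_rfl, hinj.extend_apply]
    simp [iverson]
  | fail n h =>
    have hinf : ∀ g : State N → ℝ≥0∞, ⨅ m, payoff Θ g m C [] θ θK σ = 0 := fun g =>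
      le_antisymm ((iInf_le _ n).trans (h g).le) zero_le
    simp [hinf]
  | div w hw h =>
    rw [hext .div (by simp)]
    simp only [h, iverson, if_true, mul_zero, zero_add, one_mul]

end operational

end PL

end

theorem theorem2 {N S : Type*} [Countable N] [DecidableEq N] [MeasurableSpace S]
    (Θ : PL.EntropySpace S) (θK : S) (f : PL.State N → ℝ≥0∞) (hf : Measurable f)
    (hf1 : ∀ τ, f τ ≤ 1) (C : PL.Prog N) (σ : PL.State N) :
    PL.wlp C f σ =
      (∫⁻ τ, f τ ∂(PL.opMeasureProper Θ θK C (.proper σ))) +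
      (∫⁻ θ, PL.iverson (PL.finalState Θ θK C (.proper σ) θ = .div) *
        (PL.finalScore Θ θK C (.proper σ) θ : ℝ≥0∞) ∂Θ.μ) := by
  have : MeasureTheory.IsProbabilityMeasure Θ.μ := ⟨Θ.measure_univ⟩
  have he := PL.ExtState.measurableEmbedding_proper (N := N)
  rw [PL.lintegral_opMeasureProper Θ θK C σ hf, ← MeasureTheory.lintegral_add_left]
  · simp only [← PL.iInf_payoff_eq Θ θK _ C σ hf1]
    rw [MeasureTheory.lintegral_iInf
      (fun n => PL.measurable_payoff_left hf n C [] θK σ)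
      (fun m n hmn θ => PL.antitone_payoff hf1 C [] θ θK σ hmn)]
    · simp only [PL.lintegral_payoff_nil Θ θK hf]
      exact (PL.iInf_expPayoff_nil ⟨hf, hf1⟩ C σ).symm
    · rw [PL.lintegral_payoff_nil Θ θK hf]
      exact ne_top_of_le_ne_top ENNReal.one_ne_top (PL.expPayoff_le_one hf1 0 C [] σ)
  · exact (PL.measurable_finalScore Θ θK C σ).mul
      ((he.measurable_extend hf measurable_const).comp (PL.measurable_finalState Θ θK C σ))
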